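/- Let $G$ be a second-countable, unimodular, locally compact (Hausdorff) group with a fixed Haar measure $dx$. Let $\sigma\colon G\times G\to\mathbb T$ be a 2-cocycle: a Borel measurable function with $\sigma(x,y)\sigma(xy,z)=\sigma(x,yz)\sigma(y,z)$ for all $x,y,z \in G$ and $\sigma(e,e)=1$. Let $(\pi,\mathcal H_\pi)$ be a $\sigma$-projective unitary representation of $G$ on a complex Hilbert space, i.e. a strongly continuous map $\pi$ from $G$ to the unitary operators of $\mathcal H_\pi$ with $\pi(x)\pi(y)=\sigma(x,y)\pi(xy)$ for all $x,y\in G$. Assume that $\pi$ is irreducible ($\mathcal H_\pi\neq 0$, and $0$ and $\mathcal H_\pi$ are the only closed $\pi$-invariant subspaces) and square-integrable ($\int_G|\langle\xi,\pi(x)\eta\rangle|^2\,dx<\infty$ for some nonzero $\xi,\eta\in\mathcal H_\pi$). Let $\Gamma$ be a lattice in $G$, i.e. a discrete subgroup having a fundamental domain $B$ for left translation by $\Gamma$ of finite Haar measure; its covolume $\operatorname{vol}(G/\Gamma)$ is the Haar measure of $B$, which does not depend on $B$. Then there is a unique number $d_\pi>0$, the formal dimension of $\pi$, such that for all $\xi,\eta,\xi',\eta'\in\mathcal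 H_\pi$ the integrand below is integrable and $$\int_G\langle\xi,\pi(x)\eta\rangle\,\overline{\langle\xi',\pi(x)\eta'\rangle}\,dx=d_\pi^{-1}\langle\xi,\xi'\rangle\,\overline{\langle\eta,\eta'\rangle},$$ and the following holds for all integers $n,d\ge 1$. For vectors $\eta_{i,j}\in\mathcal H_\pi$ $(1\le i\le n,\ 1\le j\le d)$, consider the family $$\big((\pi(\gamma)\eta_{i,1},\dots,\pi(\gamma)\eta_{i,d})\big)_{\gamma\in\Gamma,\ 1\le i\le n}\qquad\text{in the Hilbert space }\mathcal H_\pi^d .$$ If this family is a frame (respectively Riesz sequence, Riesz basis) for $\mathcal H_\pi^d$ for some choice of the $\eta_{i,j}$, we say that $(\pi,\Gamma)$ admits an $n$-multiwindow $d$-super frame (respectively Riesz sequence, Riesz basis). 1. If $(\pi,\Gamma)$ admits an $n$-multiwindow $d$-super frame, then $d_\pi\operatorname{vol}(G/\Gamma)\le n/d$. 2. If $(\pi,\Gamma)$ admits an $n$-multiwindow $d$-super Riesz sequence, then $d_\pi\operatorname{vol}(G/\Gamma)\ge n/d$. 3. If $(\pi,\Gamma)$ admits an $n$-multiwindow $d$-super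 Riesz basis, then $d_\pi\operatorname{vol}(G/\Gamma)=n/d$. Here a family $(e_j)_{j\in J}$ in a Hilbert space $\mathcal H$ is a frame if there are $A,B>0$ with $A\|\xi\|^2\le\sum_j|\langle\xi,e_j\rangle|^2\le B\|\xi\|^2$ for all $\xi\in\mathcal H$; a Riesz sequence if there are $A,B>0$ such that for every $c\in\ell^2(J)$ the series $\sum_j c_je_j$ converges unconditionally and $A\|c\|_2^2\le\|\sum_j c_je_j\|^2\le B\|c\|_2^2$; and a Riesz basis if it is both. -/

import Mathlib

open MeasureTheory

/-- A 2-cocycle on `G`: a Borel measurable function `G × G → 𝕋` satisfying the cocycle identity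
and normalized at the identity. -/
structure TwoCocycle (G : Type*) [Group G] [MeasurableSpace G] where
  toFun : G → G → Circle
  measurable_toFun : Measurable fun p : G × G => (toFun p.1 p.2 : ℂ)
  cocycle : ∀ x y z : G, toFun x y * toFun (x * y) z = toFun x (y * z) * toFun y z
  map_one_one : toFun 1 1 = 1

/-- A `σ`-projective unitary representation of `G` on `H`: a strongly continuous map `π` from `G`
to the unitary operators of `H` with `π(x) π(y) = σ(x, y) π(xy)`. -/
structure ProjUnitaryRep {G : Type*} [Group G] [TopologicalSpace G] [MeasurableSpace G]
    (σ : TwoCocycle G) (H : Type*) [NormedAddCommGroup H] [InnerProductSpace ℂ H] where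
  toFun : G → (H ≃ₗᵢ[ℂ] H)
  map_mul' : ∀ (x y : G) (ξ : H),
    toFun x (toFun y ξ) = (σ.toFun x y : ℂ) • toFun (x * y) ξ
  continuous' : ∀ ξ : H, Continuous fun x : G => toFun x ξ

namespace ProjUnitaryRep

variable {G : Type*} [Group G] [TopologicalSpace G] [MeasurableSpace G] {σ : TwoCocycle G}
  {H : Type*} [NormedAddCommGroup H] [InnerProductSpace ℂ H]

/-- Irreducibility: `H ≠ 0` and the only closed invariant subspaces are `0` and `H`. -/
def IsIrreducible (π : ProjUnitaryRep σ H) : Prop :=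
  Nontrivial H ∧ ∀ K : Submodule ℂ H, IsClosed (K : Set H) →
    (∀ (x : G), ∀ ξ ∈ K, π.toFun x ξ ∈ K) → K = ⊥ ∨ K = ⊤

/-- Square-integrability: some matrix coefficient of nonzero vectors is square-integrable.
(The matrix coefficient is continuous, so finiteness of the lower integral is the whole
condition.) Mathlib's inner product is linear in its second argument. -/
def IsSquareIntegrable (μ : Measure G) (π : ProjUnitaryRep σ H) : Prop :=
  ∃ ξ η : H, ξ ≠ 0 ∧ η ≠ 0 ∧ ∫⁻ x, ‖inner ℂ (π.toFun x η) ξ‖ₑ ^ 2 ∂μ < ⊤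

/-- `dπ` is the formal dimension of `π` (with respect to the Haar measure `μ`): `dπ > 0` and
`∫ ⟨ξ, π(x)η⟩ conj ⟨ξ', π(x)η'⟩ dx = dπ⁻¹ ⟨ξ, ξ'⟩ conj ⟨η, η'⟩` for all vectors, the integrand
being integrable. Here `⟨a, b⟩`, linear in `a`, is Mathlib's `inner ℂ b a`. -/
def IsFormalDimension (μ : Measure G) (π : ProjUnitaryRep σ H) (dπ : ℝ) : Prop :=
  0 < dπ ∧ ∀ ξ η ξ' η' : H,
    Integrable (fun x : G => inner ℂ (π.toFun x η) ξ *
      starRingEnd ℂ (inner ℂ (π.toFun x η') ξ')) μ ∧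
    ∫ x, inner ℂ (π.toFun x η) ξ * starRingEnd ℂ (inner ℂ (π.toFun x η') ξ') ∂μ =
      (dπ : ℂ)⁻¹ * (inner ℂ ξ' ξ * starRingEnd ℂ (inner ℂ η' η))

/-- The `n`-multiwindow `d`-super system in `H^d` (the Hilbert space direct sum) generated by the
matrix `(η i j)`: the family `(π(γ) η i 1, …, π(γ) η i d)` indexed by `γ ∈ Γ` and `1 ≤ i ≤ n`. -/
noncomputable def multiSuperSystem (π : ProjUnitaryRep σ H) (Γ : Subgroup G) {n d : ℕ}
    (η : Fin n → Fin d → H) (p : Γ × Fin n) : PiLp 2 (fun _ : Fin d => H) :=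
  WithLp.toLp 2 fun j => π.toFun (p.1 : G) (η p.2 j)

end ProjUnitaryRep

/-- The family `e` is a frame for `E`. -/
def IsFrame {J E : Type*} [NormedAddCommGroup E] [InnerProductSpace ℂ E] (e : J → E) : Prop :=
  ∃ A B : ℝ, 0 < A ∧ 0 < B ∧ ∀ ξ : E,
    Summable (fun j => ‖inner ℂ (e j) ξ‖ ^ 2) ∧
    A * ‖ξ‖ ^ 2 ≤ ∑' j, ‖inner ℂ (e j) ξ‖ ^ 2 ∧
    ∑' j, ‖inner ℂ (e j) ξ‖ ^ 2 ≤ B * ‖ξ‖ ^ 2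

/-- The family `e` is a Riesz sequence in `E`: for every `c ∈ ℓ²(J)` the series `∑ c j • e j`
converges (unconditionally) and its norm is comparable to that of `c`. -/
def IsRieszSequence {J E : Type*} [NormedAddCommGroup E] [InnerProductSpace ℂ E]
    (e : J → E) : Prop :=
  ∃ A B : ℝ, 0 < A ∧ 0 < B ∧ ∀ c : lp (fun _ : J => ℂ) 2,
    Summable (fun j => c j • e j) ∧
    A * ‖c‖ ^ 2 ≤ ‖∑' j, c j • e j‖ ^ 2 ∧
    ‖∑' j, c j • e j‖ ^ 2 ≤ B * ‖c‖ ^ 2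

/-- A Riesz basis is a family that is both a frame and a Riesz sequence. -/
def IsRieszBasis {J E : Type*} [NormedAddCommGroup E] [InnerProductSpace ℂ E]
    (e : J → E) : Prop :=
  IsFrame e ∧ IsRieszSequence e

namespace ProjUnitaryRep

variable {G : Type*} [Group G] [TopologicalSpace G] [MeasurableSpace G] {σ : TwoCocycle G}
  {H : Type*} [NormedAddCommGroup H] [InnerProductSpace ℂ H]

/-- `(π, Γ)` admits an `n`-multiwindow `d`-super frame. -/
def AdmitsSuperFrame (π : ProjUnitaryRep σ H) (Γ : Subgroup G) (n d : ℕ) : Prop :=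
  ∃ η : Fin n → Fin d → H, IsFrame (π.multiSuperSystem Γ η)

/-- `(π, Γ)` admits an `n`-multiwindow `d`-super Riesz sequence. -/
def AdmitsSuperRieszSequence (π : ProjUnitaryRep σ H) (Γ : Subgroup G) (n d : ℕ) : Prop :=
  ∃ η : Fin n → Fin d → H, IsRieszSequence (π.multiSuperSystem Γ η)

/-- `(π, Γ)` admits an `n`-multiwindow `d`-super Riesz basis. -/
def AdmitsSuperRieszBasis (π : ProjUnitaryRep σ H) (Γ : Subgroup G) (n d : ℕ) : Prop :=
  ∃ η : Fin n → Fin d → H, IsRieszBasis (π.multiSuperSystem Γ η)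

end ProjUnitaryRep

/-- `Γ` is a lattice in `G`: a discrete subgroup having a fundamental domain (for left translation)
of finite Haar measure. Its covolume is `MeasureTheory.covolume Γ G μ`, the common measure of
all fundamental domains. -/
def IsLatticeSubgroup {G : Type*} [Group G] [TopologicalSpace G] [MeasurableSpace G]
    (μ : Measure G) (Γ : Subgroup G) : Prop :=
  DiscreteTopology Γ ∧ ∃ B : Set G, IsFundamentalDomain Γ B μ ∧ μ B < ⊤

/-! Existence of `dπ` is the Godement-type orthogonality argument. For fixed η let V send ξ to its
coefficient function in L²(G), on its natural domain. V is closed and, up to phases, intertwines π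
with translation, so (1 + V*V)⁻¹ commutes with π and is scalar by Schur. Hence V is everywhere
defined and ‖Vξ‖² = C(η)‖ξ‖². Inversion invariance makes this symmetric in ξ and η, so C(η) = D‖η‖²;
polarization gives the full relations with `dπ` = D⁻¹.

For the density bounds, let T be the analysis operator of the system and R = (T*T + ε)⁻¹. Since R
T*T = 1 - εR, the sum over k of ⟨ξ, e_k⟩⟨R e_k, ξ⟩ is ‖ξ‖² - ε⟨Rξ, ξ⟩. Take ξ to be π(x)h in
coordinate j, with ‖h‖ = 1, and integrate over B. As R commutes with Γ, the sum over Γ unfolds to an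
integral over G, which orthogonality evaluates. Summing over j, d vol(B) - ε ∑_j ∫_B ⟨Rξ, ξ⟩ = dπ⁻¹
∑_i ⟨Rη_i, η_i⟩ (`sum_integral_fundamentalDomain`).

Always R ≥ 0 and ⟨R e_k, e_k⟩ ≤ 1. A frame gives ε⟨Rξ, ξ⟩ ≤ ε/(A + ε) for unit ξ; a Riesz sequence
gives ⟨R e_k, e_k⟩ ≥ A/(A + ε). Letting ε → 0 yields both inequalities. The regularization by ε
handles both cases at once, T*T being possibly non-invertible in the Riesz case. -/

set_option linter.unusedSectionVars false

/-! ### Inversion invariance and polarization. -/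

/-- A Haar measure which is also right invariant is invariant under inversion. -/
theorem MeasureTheory.Measure.IsHaarMeasure.isInvInvariant_of_isMulRightInvariant
    {G : Type*} [Group G] [TopologicalSpace G] [IsTopologicalGroup G]
    [LocallyCompactSpace G] [SecondCountableTopology G] [MeasurableSpace G] [BorelSpace G]
    (μ : Measure G) [μ.IsHaarMeasure] [μ.IsMulRightInvariant] : μ.IsInvInvariant := by
  constructor
  have hfin : IsFiniteMeasureOnCompacts μ.inv :=
    IsFiniteMeasureOnCompacts.map μ (Homeomorph.inv G)
  let c : NNReal := Measure.haarScalarFactor μ.inv μ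
  have hc : μ.inv = c • μ := Measure.isMulLeftInvariant_eq_smul μ.inv μ
  -- Inverting twice is the identity, which forces c² = 1.
  have h2 : Measure.map Inv.inv (Measure.map Inv.inv μ) = c ^ 2 • μ := by
    rw [← Measure.inv_def μ, hc, Measure.map_smul, ← Measure.inv_def μ, hc, smul_smul, pow_two]
  have μeq : μ = c ^ 2 • μ := by
    rw [Measure.map_map continuous_inv.measurable continuous_inv.measurable] at h2
    simpa only [inv_involutive, Function.Involutive.comp_self, Measure.map_id] using h2
  have K : TopologicalSpace.PositiveCompacts G := Classical.arbitrary _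
  have h3 : (c : ENNReal) ^ 2 * μ K = 1 ^ 2 * μ K := by
    conv_rhs => rw [μeq]
    simp
  have h4 : (c : ENNReal) ^ 2 = 1 ^ 2 :=
    (ENNReal.mul_left_inj (measure_pos_of_nonempty_interior _ K.interior_nonempty).ne'
          K.isCompact.measure_lt_top.ne).1 h3
  have h5 : (c : ENNReal) = 1 := (ENNReal.pow_right_strictMono two_ne_zero).injective h4
  have h6 : c = 1 := by exact_mod_cast h5
  rw [hc, h6, one_smul]

/-- A sesquilinear form vanishing on the diagonal vanishes. -/
theorem sesquilinear_eq_zero_of_diagonal {E : Type*} [AddCommGroup E] [Module ℂ E]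
    (f : E → E → ℂ) (add_left : ∀ x y z, f (x + y) z = f x z + f y z)
    (add_right : ∀ x y z, f x (y + z) = f x y + f x z)
    (smul_left : ∀ (c : ℂ) x y, f (c • x) y = starRingEnd ℂ c * f x y)
    (smul_right : ∀ (c : ℂ) x y, f x (c • y) = c * f x y)
    (diag : ∀ x, f x x = 0) (x y : E) : f x y = 0 := by
  have h1 := diag (x + y)
  -- The vector x + y controls f x y + f y x, and x + iy controls f x y - f y x.
  have h2 := diag (x + Complex.I • y)
  simp only [add_left, add_right, smul_left, smul_right, diag, Complex.conj_I] at h1 h2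
  have h3 : Complex.I * (f x y - f y x) = 0 := by linear_combination h2
  have h4 := (mul_eq_zero.1 h3).resolve_left Complex.I_ne_zero
  linear_combination (h1 + h4) / 2

/-! ### Matrix coefficients and Schur's lemma. -/

namespace ProjUnitaryRep

variable {G : Type*} [Group G] [TopologicalSpace G] [MeasurableSpace G] {σ : TwoCocycle G}
  {H : Type*} [NormedAddCommGroup H] [InnerProductSpace ℂ H]

/-- The matrix coefficient `x ↦ ⟨ξ, π(x)η⟩`. -/
noncomputable def coeff (π : ProjUnitaryRep σ H) (η ξ : H) (x : G) : ℂ := inner ℂ (π.toFun x η) ξ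

theorem map_one (π : ProjUnitaryRep σ H) (ξ : H) : π.toFun 1 ξ = ξ := by
  have h := π.map_mul' 1 1 ξ
  rw [σ.map_one_one, mul_one, Circle.coe_one, one_smul] at h
  exact (π.toFun 1).injective h

theorem map_mul (π : ProjUnitaryRep σ H) (x y : G) (ξ : H) :
    π.toFun (x * y) ξ = ((σ.toFun x y)⁻¹ : Circle) • π.toFun x (π.toFun y ξ) := by
  rw [π.map_mul', Circle.smul_def, smul_smul, ← Circle.coe_mul, inv_mul_cancel, Circle.coe_one,
    one_smul]

theorem continuous_coeff (π : ProjUnitaryRep σ H) (η ξ : H) : Continuous (π.coeff η ξ) :=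
  (π.continuous' η).inner continuous_const

theorem coeff_apply_right (π : ProjUnitaryRep σ H) (η ξ : H) (x y : G) :
    π.coeff η (π.toFun y ξ) x = σ.toFun y (y⁻¹ * x) * π.coeff η ξ (y⁻¹ * x) := by
  have h := π.map_mul y (y⁻¹ * x) η
  rw [mul_inv_cancel_left] at h
  simp only [coeff]
  rw [h, Circle.smul_def, inner_smul_left, LinearIsometryEquiv.inner_map_map,
    Circle.coe_inv_eq_conj, Complex.conj_conj]

theorem circle_mul_conj (z : Circle) : (z : ℂ) * starRingEnd ℂ (z : ℂ) = 1 := by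
  rw [Complex.mul_conj, Circle.normSq_coe, Complex.ofReal_one]

/-- The cocycle phase depends only on the group elements, not on the vectors, so it cancels against
its conjugate. -/
theorem coeff_mul_conj_coeff_apply_right (π : ProjUnitaryRep σ H) (η ξ η' ξ' : H) (x y : G) :
    π.coeff η (π.toFun y ξ) x * starRingEnd ℂ (π.coeff η' (π.toFun y ξ') x) =
      π.coeff η ξ (y⁻¹ * x) * starRingEnd ℂ (π.coeff η' ξ' (y⁻¹ * x)) := by
  rw [coeff_apply_right, coeff_apply_right, RingHom.map_mul]
  linear_combination (π.coeff η ξ (y⁻¹ * x) * starRingEnd ℂ (π.coeff η' ξ' (y⁻¹ * x))) *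
    circle_mul_conj (σ.toFun y (y⁻¹ * x))

theorem norm_coeff_inv (π : ProjUnitaryRep σ H) (η ξ : H) (x : G) :
    ‖π.coeff ξ η x⁻¹‖ = ‖π.coeff η ξ x‖ := by
  have h : inner ℂ (π.toFun x (π.toFun x⁻¹ ξ)) (π.toFun x η) = inner ℂ (π.toFun x⁻¹ ξ) η :=
    LinearIsometryEquiv.inner_map_map _ _ _
  simp only [coeff]
  rw [← h, π.map_mul', mul_inv_cancel, π.map_one, inner_smul_left, norm_mul, RCLike.norm_conj,
    Circle.norm_coe, one_mul, norm_inner_symm]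

theorem coeff_add_right (π : ProjUnitaryRep σ H) (η ξ ξ' : H) (x : G) :
    π.coeff η (ξ + ξ') x = π.coeff η ξ x + π.coeff η ξ' x := inner_add_right _ _ _

theorem coeff_add_left (π : ProjUnitaryRep σ H) (η η' ξ : H) (x : G) :
    π.coeff (η + η') ξ x = π.coeff η ξ x + π.coeff η' ξ x := by
  simp [coeff]

theorem coeff_smul_right (π : ProjUnitaryRep σ H) (η ξ : H) (c : ℂ) (x : G) :
    π.coeff η (c • ξ) x = c * π.coeff η ξ x := inner_smul_right _ _ _

theorem coeff_smul_left (π : ProjUnitaryRep σ H) (η ξ : H) (c : ℂ) (x : G) :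
    π.coeff (c • η) ξ x = starRingEnd ℂ c * π.coeff η ξ x := by
  simp [coeff, mul_comm]

/-- **Schur's lemma** for self-adjoint operators. -/
theorem IsIrreducible.exists_eq_algebraMap [CompleteSpace H] {π : ProjUnitaryRep σ H}
    (hπ : π.IsIrreducible) {A : H →L[ℂ] H} (hA : IsSelfAdjoint A)
    (hcomm : ∀ x ξ, A (π.toFun x ξ) = π.toFun x (A ξ)) :
    ∃ c : ℝ, A = algebraMap ℝ (H →L[ℂ] H) c := by
  have : Nontrivial H := hπ.1
  have hcfc : ∀ (f : ℝ → ℝ) x ξ, cfc f A (π.toFun x ξ) = π.toFun x (cfc f A ξ) := by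
    intro f x ξ
    have h : Commute A ((π.toFun x).toContinuousLinearEquiv : H →L[ℂ] H) := by
      ext ξ
      exact hcomm x ξ
    have h2 := h.cfc_real f
    exact congrArg (fun T : H →L[ℂ] H => T ξ) h2.eq
  -- The kernel of f(A) is closed and invariant, hence trivial or everything, and it contains the
  -- range of g(A).
  have hzero : ∀ f g : ℝ → ℝ, Continuous f → Continuous g → (∀ t, f t * g t = 0) →
      cfc f A = 0 ∨ cfc g A = 0 := by
    intro f g hf hg hfg
    have hmul : cfc f A * cfc g A = 0 := by
      rw [← cfc_mul f g A hf.continuousOn hg.continuousOn]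
      simp [hfg]
    rcases hπ.2 (cfc f A).ker (cfc f A).isClosed_ker (by
      intro x ξ hξ
      rw [LinearMap.mem_ker] at hξ ⊢
      change cfc f A (π.toFun x ξ) = 0
      rw [hcfc]
      change cfc f A ξ = 0 at hξ
      rw [hξ, _root_.map_zero]) with h | h
    · right
      ext ξ
      have : cfc g A ξ ∈ (cfc f A).ker := by
        rw [LinearMap.mem_ker]
        exact congrArg (fun T : H →L[ℂ] H => T ξ) hmul
      rw [h] at this
      simpa using this
    · left
      ext ξ
      have : ξ ∈ (cfc f A).ker := by rw [h]; trivial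
      exact this
  have hne : (spectrum ℝ A).Nonempty :=
    ContinuousFunctionalCalculus.spectrum_nonempty A hA
  obtain ⟨c, hc⟩ := hne
  refine ⟨c, CFC.eq_algebraMap_of_spectrum_subset_singleton A c ?_ hA⟩
  have key : ∀ f : ℝ → ℝ, Continuous f → cfc f A = 0 → ∀ t ∈ spectrum ℝ A, f t = 0 := by
    intro f hf h0 t ht
    have h1 : f t ∈ spectrum ℝ (cfc f A) := by
      rw [cfc_map_spectrum f A hA hf.continuousOn]
      exact ⟨t, ht, rfl⟩
    rw [h0] at h1
    simpa using h1
  intro t ht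
  by_contra hne
  -- Two distinct spectral points would carry tent functions with zero product, neither killing A.
  have hd : 0 < |t - c| := abs_pos.2 (sub_ne_zero.2 hne)
  have hf : Continuous fun s : ℝ => max (|t - c| / 2 - |s - c|) 0 := by fun_prop
  have hg : Continuous fun s : ℝ => max (|t - c| / 2 - |s - t|) 0 := by fun_prop
  rcases hzero _ _ hf hg (by
    intro s
    rcases le_or_gt (|t - c| / 2) |s - c| with h | h
    · rw [max_eq_right (by linarith), zero_mul]
    · have := abs_sub_le t s c
      rw [abs_sub_comm t s] at this
      rw [max_eq_right (a := |t - c| / 2 - |s - t|) (by linarith), mul_zero]) with h | h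
  · have := key _ hf h c hc
    simp only [sub_self, abs_zero, sub_zero] at this
    rw [max_eq_left (by linarith)] at this
    linarith
  · have := key _ hg h t ht
    simp only [sub_self, abs_zero, sub_zero] at this
    rw [max_eq_left (by linarith)] at this
    linarith

end ProjUnitaryRep

/-! ### Orthogonality relations and the formal dimension. -/

namespace ProjUnitaryRep

variable {G : Type*} [Group G] [TopologicalSpace G] [IsTopologicalGroup G]
  [SecondCountableTopology G] [MeasurableSpace G] [BorelSpace G]
  {σ : TwoCocycle G} {H : Type*} [NormedAddCommGroup H] [InnerProductSpace ℂ H]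

theorem aestronglyMeasurable_coeff (μ : Measure G) (π : ProjUnitaryRep σ H) (η ξ : H) :
    AEStronglyMeasurable (π.coeff η ξ) μ :=
  (π.continuous_coeff η ξ).aestronglyMeasurable

theorem memLp_coeff_apply_right (μ : Measure G) [μ.IsHaarMeasure] (π : ProjUnitaryRep σ H)
    {η ξ : H} (y : G) (h : MemLp (π.coeff η ξ) 2 μ) : MemLp (π.coeff η (π.toFun y ξ)) 2 μ := by
  have h1 := h.comp_measurePreserving (measurePreserving_mul_left μ y⁻¹)
  refine h1.congr_norm (π.aestronglyMeasurable_coeff μ _ _) (Filter.Eventually.of_forall fun x => ?_)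
  rw [coeff_apply_right, norm_mul, Circle.norm_coe, one_mul]
  rfl

theorem memLp_coeff_swap (μ : Measure G) [μ.IsInvInvariant] (π : ProjUnitaryRep σ H)
    {η ξ : H} (h : MemLp (π.coeff η ξ) 2 μ) : MemLp (π.coeff ξ η) 2 μ := by
  have h1 := h.comp_measurePreserving (Measure.measurePreserving_inv μ)
  refine h1.congr_norm (π.aestronglyMeasurable_coeff μ _ _) (Filter.Eventually.of_forall fun x => ?_)
  exact π.norm_coeff_inv _ _ _

theorem integral_norm_coeff_swap (μ : Measure G) [μ.IsInvInvariant] (π : ProjUnitaryRep σ H)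
    (η ξ : H) : ∫ x, ‖π.coeff ξ η x‖ ^ 2 ∂μ = ∫ x, ‖π.coeff η ξ x‖ ^ 2 ∂μ := by
  rw [← integral_inv_eq_self (fun x => ‖π.coeff ξ η x‖ ^ 2) μ]
  simp only [norm_coeff_inv]

/-- The graph of `ξ ↦ π.coeff η ξ` in `H × L²(G)`, restricted to the `ξ` with square-integrable
image. -/
def coeffGraph (μ : Measure G) (π : ProjUnitaryRep σ H) (η : H) :
    Submodule ℂ (WithLp 2 (H × Lp ℂ 2 μ)) where
  carrier := {p | p.snd =ᵐ[μ] π.coeff η p.fst}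
  zero_mem' := by
    filter_upwards [Lp.coeFn_zero ℂ 2 μ] with x hx
    change (0 : Lp ℂ 2 μ) x = inner ℂ _ (0 : H)
    rw [hx, inner_zero_right, Pi.zero_apply]
  add_mem' := by
    intro p q hp hq
    filter_upwards [hp, hq, Lp.coeFn_add p.snd q.snd] with x h1 h2 h3
    rw [WithLp.add_snd, WithLp.add_fst, h3, coeff_add_right, Pi.add_apply, h1, h2]
  smul_mem' := by
    intro c p hp
    filter_upwards [hp, Lp.coeFn_smul c p.snd] with x h1 h3
    rw [WithLp.smul_snd, WithLp.smul_fst, h3, coeff_smul_right, Pi.smul_apply, h1, smul_eq_mul]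

/-- An L² limit is an a.e. limit along a subsequence, while coefficients converge pointwise as ξ
varies; the two limits agree. -/
theorem isClosed_coeffGraph (μ : Measure G) (π : ProjUnitaryRep σ H) (η : H) :
    IsClosed (coeffGraph μ π η : Set (WithLp 2 (H × Lp ℂ 2 μ))) := by
  refine IsSeqClosed.isClosed ?_
  intro u p hu hp
  have h1 : Filter.Tendsto (fun n => (u n).fst) Filter.atTop (nhds p.fst) :=
    ((WithLp.fstL 2 ℂ H (Lp ℂ 2 μ)).continuous.tendsto p).comp hp
  have h2 : Filter.Tendsto (fun n => (u n).snd) Filter.atTop (nhds p.snd) :=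
    ((WithLp.sndL 2 ℂ H (Lp ℂ 2 μ)).continuous.tendsto p).comp hp
  obtain ⟨φ, hφ, hlim⟩ := (tendstoInMeasure_of_tendsto_Lp h2).exists_seq_tendsto_ae
  have h3 : ∀ᵐ x ∂μ, ∀ n, (u n).snd x = π.coeff η (u n).fst x := ae_all_iff.2 hu
  filter_upwards [hlim, h3] with x hx1 hx2
  refine tendsto_nhds_unique hx1 ?_
  simp only [hx2]
  exact Filter.Tendsto.inner tendsto_const_nhds (h1.comp hφ.tendsto_atTop)

/-- For fixed `η`, there is a self-adjoint operator `A` for which `A h` is the unique weak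
solution `a` of `(1 + V*V) a = h`, where `V a = π.coeff η a`. -/
theorem exists_resolvent [CompleteSpace H] (μ : Measure G) (π : ProjUnitaryRep σ H) (η : H) :
    ∃ A : H →L[ℂ] H, IsSelfAdjoint A ∧ ∀ h a : H, A h = a ↔
      (MemLp (π.coeff η a) 2 μ ∧ ∀ b, MemLp (π.coeff η b) 2 μ →
        inner ℂ b (h - a) = ∫ x, π.coeff η a x * starRingEnd ℂ (π.coeff η b x) ∂μ) := by
  let K := coeffGraph μ π η
  have : CompleteSpace K := (isClosed_coeffGraph μ π η).completeSpace_coe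
  let J : H →L[ℂ] WithLp 2 (H × Lp ℂ 2 μ) :=
    (WithLp.prodContinuousLinearEquiv 2 ℂ H (Lp ℂ 2 μ)).symm.toContinuousLinearMap ∘L
      ContinuousLinearMap.inl ℂ H (Lp ℂ 2 μ)
  have hJ : ∀ h, J h = WithLp.toLp 2 (h, 0) := fun h => rfl
  have hJadj : ∀ k, J.adjoint k = k.fst := by
    intro k
    refine ext_inner_right ℂ fun ξ => ?_
    rw [ContinuousLinearMap.adjoint_inner_left, hJ, WithLp.prod_inner_apply]
    simp
  -- Project (h, 0) onto the graph and keep the first component: orthogonality of (h - a, -Va) to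
  -- the graph is the weak equation.
  refine ⟨J.adjoint ∘L K.starProjection ∘L J,
    (isSelfAdjoint_starProjection K).adjoint_conj J, ?_⟩
  have hmem : ∀ p ∈ K, MemLp (π.coeff η p.fst) 2 μ := fun p hp =>
    (Lp.memLp p.snd).ae_eq hp
  have hinner : ∀ p ∈ K, ∀ q ∈ K, inner ℂ q.snd p.snd =
      ∫ x, π.coeff η p.fst x * starRingEnd ℂ (π.coeff η q.fst x) ∂μ := by
    intro p hp q hq
    rw [L2.inner_def]
    refine integral_congr_ae ?_
    filter_upwards [hp, hq] with x h1 h2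
    rw [h1, h2]
    rfl
  have hsub : ∀ (h : H) (p q : WithLp 2 (H × Lp ℂ 2 μ)), inner ℂ q (J h - p) =
      inner ℂ q.fst (h - p.fst) - inner ℂ q.snd p.snd := by
    intro h p q
    rw [WithLp.prod_inner_apply]
    change inner ℂ q.fst (h - p.fst) + inner ℂ q.snd (0 - p.snd) = _
    rw [zero_sub, inner_neg_right, ← sub_eq_add_neg]
  intro h a
  simp only [ContinuousLinearMap.comp_apply, hJadj]
  constructor
  · intro ha
    have hQ : K.starProjection (J h) ∈ K := Submodule.starProjection_apply_mem K (J h)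
    refine ⟨ha ▸ hmem _ hQ, fun b hb => ?_⟩
    have hbK : WithLp.toLp 2 (b, hb.toLp) ∈ K := hb.coeFn_toLp
    have h0 := Submodule.starProjection_inner_eq_zero (K := K) (J h) _ hbK
    rw [← inner_conj_symm, map_eq_zero_iff _ (RingHom.injective _), hsub, hinner _ hQ _ hbK, ha,
      sub_eq_zero] at h0
    exact h0
  · rintro ⟨ha, hb⟩
    have haK : WithLp.toLp 2 (a, ha.toLp) ∈ K := ha.coeFn_toLp
    have h1 := Submodule.eq_starProjection_of_mem_of_inner_eq_zero (K := K) (u := J h) haK (by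
      intro w hw
      rw [← inner_conj_symm, map_eq_zero_iff _ (RingHom.injective _), hsub, hinner _ haK _ hw,
        sub_eq_zero]
      exact hb _ (hmem _ hw))
    rw [h1]
    rfl

theorem exists_integral_norm_coeff [CompleteSpace H] (μ : Measure G) [μ.IsHaarMeasure]
    {π : ProjUnitaryRep σ H} (hπ : π.IsIrreducible) {η ξ₀ : H} (hξ₀ : ξ₀ ≠ 0)
    (h₀ : MemLp (π.coeff η ξ₀) 2 μ) :
    ∃ C : ℝ, ∀ ξ, MemLp (π.coeff η ξ) 2 μ ∧ ∫ x, ‖π.coeff η ξ x‖ ^ 2 ∂μ = C * ‖ξ‖ ^ 2 := by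
  obtain ⟨A, hA, hsol⟩ := exists_resolvent μ π η
  obtain ⟨c, hc⟩ := hπ.exists_eq_algebraMap hA (by
    intro y h
    rw [hsol]
    obtain ⟨h1, h2⟩ := (hsol h _).1 rfl
    refine ⟨π.memLp_coeff_apply_right μ y h1, fun b hb => ?_⟩
    have hyb : MemLp (π.coeff η ((π.toFun y).symm b)) 2 μ := by
      have h3 := hb.comp_measurePreserving (measurePreserving_mul_left μ y)
      refine h3.congr_norm (π.aestronglyMeasurable_coeff μ _ _)
        (Filter.Eventually.of_forall fun x => ?_)
      have h4 := π.coeff_apply_right η ((π.toFun y).symm b) (y * x) y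
      rw [LinearIsometryEquiv.apply_symm_apply, inv_mul_cancel_left] at h4
      simp only [Function.comp_apply]
      rw [h4, norm_mul, Circle.norm_coe, one_mul]
    have h5 := h2 _ hyb
    obtain ⟨b, rfl⟩ := (π.toFun y).surjective b
    rw [LinearIsometryEquiv.symm_apply_apply] at h5
    rw [← map_sub, LinearIsometryEquiv.inner_map_map, h5]
    simp only [coeff_mul_conj_coeff_apply_right]
    exact (integral_mul_left_eq_self
      (fun x => π.coeff η (A h) x * starRingEnd ℂ (π.coeff η b x)) y⁻¹).symm)
  have hAh : ∀ h, A h = (c : ℂ) • h := by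
    intro h
    rw [hc, Algebra.algebraMap_eq_smul_one]
    simp
  -- If c = 0, then a = 0 solves the equation for h = ξ₀; testing against b = ξ₀ gives ‖ξ₀‖² = 0.
  have hc0 : (c : ℂ) ≠ 0 := by
    intro hc0
    apply hξ₀
    have h1 := ((hsol ξ₀ 0).1 (by rw [hAh, hc0, zero_smul])).2 ξ₀ h₀
    simpa [coeff] using h1
  have hmem : ∀ ξ, MemLp (π.coeff η ξ) 2 μ := by
    intro ξ
    have h1 := ((hsol ((c : ℂ)⁻¹ • ξ) ξ).1 (by rw [hAh, smul_smul, mul_inv_cancel₀ hc0, one_smul])).1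
    exact h1
  -- The constant comes from the weak equation with h = c⁻¹ξ and a = b = ξ.
  refine ⟨c⁻¹ - 1, fun ξ => ⟨hmem ξ, ?_⟩⟩
  have h1 := ((hsol ((c : ℂ)⁻¹ • ξ) ξ).1
    (by rw [hAh, smul_smul, mul_inv_cancel₀ hc0, one_smul])).2 ξ (hmem ξ)
  simp only [RCLike.mul_conj] at h1
  rw [inner_sub_right, inner_smul_right, inner_self_eq_norm_sq_to_K] at h1
  have h2 : ∫ x, ((‖π.coeff η ξ x‖ : ℂ)) ^ 2 ∂μ = ((∫ x, ‖π.coeff η ξ x‖ ^ 2 ∂μ : ℝ) : ℂ) := by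
    rw [← integral_complex_ofReal]
    simp
  apply Complex.ofReal_injective
  rw [← h2]
  refine h1.symm.trans ?_
  simp
  ring

theorem exists_isFormalDimension [LocallyCompactSpace G] [CompleteSpace H] (μ : Measure G) [μ.IsHaarMeasure]
    [μ.IsMulRightInvariant] {π : ProjUnitaryRep σ H} (hπ : π.IsIrreducible)
    (hsq : π.IsSquareIntegrable μ) : ∃ dπ, π.IsFormalDimension μ dπ := by
  have := Measure.IsHaarMeasure.isInvInvariant_of_isMulRightInvariant μ
  obtain ⟨ξ₀, η₀, hξ₀, hη₀, h₀⟩ := hsq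
  have hmem₀ : MemLp (π.coeff η₀ ξ₀) 2 μ := by
    refine ⟨π.aestronglyMeasurable_coeff μ _ _, ?_⟩
    rw [eLpNorm_lt_top_iff_lintegral_rpow_enorm_lt_top two_ne_zero ENNReal.ofNat_ne_top]
    simpa [coeff] using h₀
  obtain ⟨C₀, hC₀⟩ := exists_integral_norm_coeff μ hπ hξ₀ hmem₀
  -- All coefficients built from η₀ are in L²; swapping by inversion puts the nonzero vector η₀ in
  -- the domain belonging to every η.
  have hex : ∀ η, ∃ C : ℝ, ∀ ξ, MemLp (π.coeff η ξ) 2 μ ∧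
      ∫ x, ‖π.coeff η ξ x‖ ^ 2 ∂μ = C * ‖ξ‖ ^ 2 := fun η =>
    exists_integral_norm_coeff μ hπ hη₀ (π.memLp_coeff_swap μ (hC₀ η).1)
  choose C hC using hex
  have hmem : ∀ η ξ, MemLp (π.coeff η ξ) 2 μ := fun η ξ => (hC η ξ).1
  have hsymm : ∀ η ξ, C η * ‖ξ‖ ^ 2 = C ξ * ‖η‖ ^ 2 := by
    intro η ξ
    rw [← (hC η ξ).2, ← (hC ξ η).2, integral_norm_coeff_swap]
  have hη₀n : ‖η₀‖ ^ 2 ≠ 0 := by simpa using hη₀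
  obtain ⟨D, hD⟩ : ∃ D : ℝ, ∀ η ξ, ∫ x, ‖π.coeff η ξ x‖ ^ 2 ∂μ = D * (‖ξ‖ ^ 2 * ‖η‖ ^ 2) := by
    refine ⟨C η₀ / ‖η₀‖ ^ 2, fun η ξ => ?_⟩
    rw [(hC η ξ).2]
    have := hsymm η η₀
    field_simp
    linear_combination ‖ξ‖ ^ 2 * this
  have hDpos : 0 < D := by
    have h1 : 0 < ∫ x, ‖π.coeff η₀ η₀ x‖ ^ 2 ∂μ := by
      refine integral_pos_of_integrable_nonneg_nonzero
        ((π.continuous_coeff η₀ η₀).norm.pow 2)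
        ((memLp_two_iff_integrable_sq_norm (π.aestronglyMeasurable_coeff μ _ _)).1 (hmem _ _))
        (fun x => sq_nonneg _) (x := 1) ?_
      simpa [coeff, map_one] using hη₀
    rw [hD] at h1
    exact pos_of_mul_pos_left h1 (by positivity)
  have hint : ∀ η ξ η' ξ', Integrable
      (fun x => π.coeff η ξ x * starRingEnd ℂ (π.coeff η' ξ' x)) μ := by
    intro η ξ η' ξ'
    have h1 : MemLp (fun x => starRingEnd ℂ (π.coeff η' ξ' x)) 2 μ := (hmem η' ξ').star
    exact (hmem η ξ).integrable_mul h1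
  have hdiag : ∀ η ξ, ∫ x, π.coeff η ξ x * starRingEnd ℂ (π.coeff η ξ x) ∂μ =
      D * (inner ℂ ξ ξ * inner ℂ η η) := by
    intro η ξ
    simp only [RCLike.mul_conj, inner_self_eq_norm_sq_to_K]
    have h2 : ∫ x, ((‖π.coeff η ξ x‖ : ℂ)) ^ 2 ∂μ = ((∫ x, ‖π.coeff η ξ x‖ ^ 2 ∂μ : ℝ) : ℂ) := by
      rw [← integral_complex_ofReal]
      simp
    refine h2.trans ?_
    rw [hD]
    simp
  have hpol1 : ∀ η ξ ξ', ∫ x, π.coeff η ξ x * starRingEnd ℂ (π.coeff η ξ' x) ∂μ =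
      D * (inner ℂ ξ' ξ * inner ℂ η η) := by
    intro η ξ ξ'
    rw [← sub_eq_zero]
    refine sesquilinear_eq_zero_of_diagonal
      (fun ξ' ξ => ∫ x, π.coeff η ξ x * starRingEnd ℂ (π.coeff η ξ' x) ∂μ -
        D * (inner ℂ ξ' ξ * inner ℂ η η)) ?_ ?_ ?_ ?_ ?_ ξ' ξ
    · intro a b z
      simp only [coeff_add_right, map_add, mul_add, inner_add_left]
      rw [integral_add (hint _ _ _ _) (hint _ _ _ _)]
      ring
    · intro z a b
      simp only [coeff_add_right, add_mul, inner_add_right]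
      rw [integral_add (hint _ _ _ _) (hint _ _ _ _)]
      ring
    · intro c a b
      simp only [coeff_smul_right, RingHom.map_mul, inner_smul_left, mul_left_comm _ (starRingEnd ℂ c)]
      rw [integral_const_mul]
      ring
    · intro c a b
      simp only [coeff_smul_right, inner_smul_right, mul_assoc]
      rw [integral_const_mul]
      ring
    · intro a
      simp only [hdiag, sub_self]
  have hpol2 : ∀ η ξ η' ξ', ∫ x, π.coeff η ξ x * starRingEnd ℂ (π.coeff η' ξ' x) ∂μ =
      D * (inner ℂ ξ' ξ * inner ℂ η η') := by
    intro η ξ η' ξ'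
    rw [← sub_eq_zero]
    refine sesquilinear_eq_zero_of_diagonal
      (fun η η' => ∫ x, π.coeff η ξ x * starRingEnd ℂ (π.coeff η' ξ' x) ∂μ -
        D * (inner ℂ ξ' ξ * inner ℂ η η')) ?_ ?_ ?_ ?_ ?_ η η'
    · intro a b z
      simp only [coeff_add_left, add_mul, inner_add_left]
      rw [integral_add (hint _ _ _ _) (hint _ _ _ _)]
      ring
    · intro z a b
      simp only [coeff_add_left, map_add, mul_add, inner_add_right]
      rw [integral_add (hint _ _ _ _) (hint _ _ _ _)]
      ring
    · intro c a b
      simp only [coeff_smul_left, inner_smul_left, mul_assoc]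
      rw [integral_const_mul]
      ring
    · intro c a b
      simp only [coeff_smul_left, RingHom.map_mul, Complex.conj_conj, inner_smul_right,
        mul_left_comm _ c]
      rw [integral_const_mul]
      ring
    · intro a
      simp only [hpol1, sub_self]
  refine ⟨D⁻¹, inv_pos.2 hDpos, fun ξ η ξ' η' => ⟨hint _ _ _ _, (hpol2 η ξ η' ξ').trans ?_⟩⟩
  rw [inner_conj_symm]
  simp

theorem IsFormalDimension.unique {μ : Measure G} {π : ProjUnitaryRep σ H} [Nontrivial H]
    {d d' : ℝ} (h : π.IsFormalDimension μ d) (h' : π.IsFormalDimension μ d') : d = d' := by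
  obtain ⟨ξ, hξ⟩ := exists_ne (0 : H)
  have h1 := (h.2 ξ ξ ξ ξ).2.symm.trans (h'.2 ξ ξ ξ ξ).2
  have h2 : inner ℂ ξ ξ ≠ 0 := inner_self_ne_zero.2 hξ
  have h3 := mul_right_cancel₀ (mul_ne_zero h2 (by simpa using hξ)) h1
  exact_mod_cast inv_injective h3

end ProjUnitaryRep

/-! ### Analysis operators and regularized frame operators. -/

section AnalysisOperator

variable {J E : Type*} [NormedAddCommGroup E] [InnerProductSpace ℂ E]

/-- `T` is the analysis operator `ξ ↦ (⟨ξ, e k⟩)ₖ` of the family `e`. -/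
def IsAnalysisOperator (e : J → E) (T : E →L[ℂ] lp (fun _ : J => ℂ) 2) : Prop :=
  ∀ ξ k, T ξ k = inner ℂ (e k) ξ

theorem lp_norm_sq_eq_tsum (c : lp (fun _ : J => ℂ) 2) : ‖c‖ ^ 2 = ∑' k, ‖c k‖ ^ 2 := by
  have h := lp.norm_rpow_eq_tsum (p := 2) (by norm_num) c
  simpa using h

theorem IsFrame.exists_analysisOperator {e : J → E} (he : IsFrame e) :
    ∃ T : E →L[ℂ] lp (fun _ : J => ℂ) 2, IsAnalysisOperator e T ∧
      ∃ A : ℝ, 0 < A ∧ ∀ ξ, A * ‖ξ‖ ^ 2 ≤ ‖T ξ‖ ^ 2 := by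
  obtain ⟨A, B, hA, hB, h⟩ := he
  have hmem : ∀ ξ, Memℓp (fun k => inner ℂ (e k) ξ) 2 := fun ξ =>
    memℓp_gen (by simpa using (h ξ).1)
  let T₀ : E →ₗ[ℂ] lp (fun _ : J => ℂ) 2 :=
    { toFun := fun ξ => ⟨fun k => inner ℂ (e k) ξ, hmem ξ⟩
      map_add' := fun ξ ξ' => by
        ext k
        exact inner_add_right _ _ _
      map_smul' := fun c ξ => by
        ext k
        exact inner_smul_right _ _ _ }
  have hn : ∀ ξ, ‖T₀ ξ‖ ^ 2 = ∑' k, ‖inner ℂ (e k) ξ‖ ^ 2 := fun ξ => lp_norm_sq_eq_tsum _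
  refine ⟨T₀.mkContinuous √B fun ξ => ?_, fun ξ k => rfl, A, hA, fun ξ => ?_⟩
  · refine le_of_sq_le_sq ?_ (by positivity)
    rw [hn, mul_pow, Real.sq_sqrt hB.le]
    exact (h ξ).2.2
  · exact (h ξ).2.1.trans_eq (hn ξ).symm

/-- The Riesz bounds concern the synthesis operator, so T is obtained as its adjoint. -/
theorem IsRieszSequence.exists_analysisOperator [CompleteSpace E] {e : J → E}
    (he : IsRieszSequence e) :
    ∃ T : E →L[ℂ] lp (fun _ : J => ℂ) 2, IsAnalysisOperator e T ∧
      ∃ A : ℝ, 0 < A ∧ ∀ c, A * ‖c‖ ^ 2 ≤ ‖T.adjoint c‖ ^ 2 := by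
  classical
  obtain ⟨A, B, hA, hB, h⟩ := he
  let U₀ : lp (fun _ : J => ℂ) 2 →ₗ[ℂ] E :=
    { toFun := fun c => ∑' k, c k • e k
      map_add' := fun c c' => by
        rw [← (h c).1.tsum_add (h c').1]
        simp [add_smul]
      map_smul' := fun a c => by
        rw [RingHom.id_apply, ← (h c).1.tsum_const_smul]
        simp [mul_smul] }
  let U : lp (fun _ : J => ℂ) 2 →L[ℂ] E := U₀.mkContinuous √B fun c => by
    refine le_of_sq_le_sq ?_ (by positivity)
    rw [mul_pow, Real.sq_sqrt hB.le]
    exact (h c).2.2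
  refine ⟨U.adjoint, fun ξ k => ?_, A, hA, fun c => ?_⟩
  · have h1 : U (lp.single 2 k (1 : ℂ)) = e k := by
      change ∑' l, (lp.single 2 k (1 : ℂ) : lp (fun _ : J => ℂ) 2) l • e l = e k
      rw [tsum_eq_single k]
      · simp
      · intro l hl
        simp [hl]
    have h2 := ContinuousLinearMap.adjoint_inner_right U (lp.single 2 k (1 : ℂ)) ξ
    rw [lp.inner_single_left, h1] at h2
    simpa using h2
  · rw [ContinuousLinearMap.adjoint_adjoint]
    exact (h c).2.1

/-- `R` is the resolvent `(T*T + ε)⁻¹` of the frame operator `T*T`. -/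
structure IsFrameResolvent {F : Type*} [NormedAddCommGroup F] [InnerProductSpace ℂ F]
    [CompleteSpace E] [CompleteSpace F] (T : E →L[ℂ] F) (ε : ℝ) (R : E →L[ℂ] E) : Prop where
  right_inv : ∀ x, T.adjoint (T (R x)) + (ε : ℂ) • R x = x
  left_inv : ∀ x, R (T.adjoint (T x) + (ε : ℂ) • x) = x

variable {F : Type*} [NormedAddCommGroup F] [InnerProductSpace ℂ F]
    [CompleteSpace E] [CompleteSpace F] {T : E →L[ℂ] F} {ε : ℝ} {R : E →L[ℂ] E}

theorem exists_isFrameResolvent (T : E →L[ℂ] F) (hε : 0 < ε) : ∃ R, IsFrameResolvent T ε R := by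
  let S : E →L[ℂ] E := T.adjoint ∘L T + (ε : ℂ) • ContinuousLinearMap.id ℂ E
  have hS : ∀ x, S x = T.adjoint (T x) + (ε : ℂ) • x := fun x => rfl
  have hu : IsUnit S := by
    refine ContinuousLinearMap.isUnit_of_forall_le_norm_inner_map S (c := ⟨ε, hε.le⟩) hε fun x => ?_
    refine le_trans ?_ (RCLike.re_le_norm _)
    rw [hS, inner_add_left, ContinuousLinearMap.adjoint_inner_left, inner_smul_left,
      inner_self_eq_norm_sq_to_K, inner_self_eq_norm_sq_to_K, Complex.conj_ofReal]
    have h1 : RCLike.re (((‖T x‖ : ℂ)) ^ 2 + (ε : ℂ) * ((‖x‖ : ℂ)) ^ 2) =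
        ‖T x‖ ^ 2 + ε * ‖x‖ ^ 2 := by
      norm_cast
    refine le_trans ?_ h1.ge
    have := sq_nonneg ‖T x‖
    change ‖x‖ ^ 2 * ε ≤ _
    linarith
  obtain ⟨u, hu⟩ := hu
  refine ⟨(↑u⁻¹ : E →L[ℂ] E), fun x => ?_, fun x => ?_⟩
  · rw [← hS, ← hu]
    exact congrArg (fun V : E →L[ℂ] E => V x) u.mul_inv
  · rw [← hS, ← hu]
    exact congrArg (fun V : E →L[ℂ] E => V x) u.inv_mul

namespace IsFrameResolvent

theorem inner_symm (hR : IsFrameResolvent T ε R) (x y : E) : inner ℂ (R x) y = inner ℂ x (R y) := by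
  conv_lhs => rw [← hR.right_inv y]
  conv_rhs => rw [← hR.right_inv x]
  simp only [inner_add_left, inner_add_right, ContinuousLinearMap.adjoint_inner_left,
    ContinuousLinearMap.adjoint_inner_right, inner_smul_left, inner_smul_right,
    Complex.conj_ofReal]

theorem re_inner_self (hR : IsFrameResolvent T ε R) (x : E) :
    (inner ℂ x (R x)).re = ‖T (R x)‖ ^ 2 + ε * ‖R x‖ ^ 2 := by
  conv_lhs => enter [1, 2]; rw [← hR.right_inv x]
  rw [inner_add_left, ContinuousLinearMap.adjoint_inner_left, inner_smul_left,
      inner_self_eq_norm_sq_to_K, inner_self_eq_norm_sq_to_K, Complex.conj_ofReal]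
  have h1 : (((‖T (R x)‖ : ℂ)) ^ 2 + (ε : ℂ) * ((‖R x‖ : ℂ)) ^ 2).re =
        ‖T (R x)‖ ^ 2 + ε * ‖R x‖ ^ 2 := by
      norm_cast
  exact h1

theorem re_inner_self_nonneg (hR : IsFrameResolvent T ε R) (hε : 0 < ε) (x : E) :
    0 ≤ (inner ℂ x (R x)).re := by
  rw [hR.re_inner_self]
  positivity

/-- (A + ε)‖Rx‖² ≤ Re⟨x, Rx⟩ ≤ ‖x‖‖Rx‖, so (A + ε)‖Rx‖ ≤ ‖x‖; apply Cauchy–Schwarz again. -/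
theorem mul_re_inner_self_le (hR : IsFrameResolvent T ε R) (hε : 0 < ε) {A : ℝ} (hA : 0 ≤ A)
    (hT : ∀ x, A * ‖x‖ ^ 2 ≤ ‖T x‖ ^ 2) (x : E) :
    (A + ε) * (inner ℂ x (R x)).re ≤ ‖x‖ ^ 2 := by
  have h1 := hR.re_inner_self x
  have h2 : (inner ℂ x (R x)).re ≤ ‖x‖ * ‖R x‖ :=
    (Complex.re_le_norm _).trans (norm_inner_le_norm _ _)
  have h3 := hT (R x)
  have h4 : (A + ε) * ‖R x‖ ≤ ‖x‖ := by
    rcases (norm_nonneg (R x)).eq_or_lt with h | h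
    · rw [← h]
      simp
    · refine le_of_mul_le_mul_right ?_ h
      nlinarith
  calc (A + ε) * (inner ℂ x (R x)).re ≤ (A + ε) * (‖x‖ * ‖R x‖) := by gcongr
    _ = ‖x‖ * ((A + ε) * ‖R x‖) := by ring
    _ ≤ ‖x‖ * ‖x‖ := by gcongr
    _ = ‖x‖ ^ 2 := by ring

theorem commute (hR : IsFrameResolvent T ε R) (ρ : E ≃ₗᵢ[ℂ] E)
    (hρ : ∀ x y, inner ℂ (T (ρ y)) (T (ρ x)) = inner ℂ (T y) (T x)) (x : E) :
    R (ρ x) = ρ (R x) := by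
  have h : ∀ x, T.adjoint (T (ρ x)) = ρ (T.adjoint (T x)) := by
    intro x
    refine ext_inner_left ℂ fun y => ?_
    obtain ⟨y, rfl⟩ := ρ.surjective y
    rw [ContinuousLinearMap.adjoint_inner_right, hρ, LinearIsometryEquiv.inner_map_map,
      ContinuousLinearMap.adjoint_inner_right]
  conv_lhs => rw [← hR.right_inv x, map_add, map_smul, ← h, hR.left_inv]

end IsFrameResolvent

variable {e : J → E} {T : E →L[ℂ] lp (fun _ : J => ℂ) 2}

/-- Expand ⟨TRξ, Tξ⟩ in coordinates, and evaluate it by R T*T = 1 - εR. -/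
theorem IsFrameResolvent.hasSum (hR : IsFrameResolvent T ε R) (hT : IsAnalysisOperator e T)
    (ξ : E) : HasSum (fun k => inner ℂ (e k) ξ * inner ℂ ξ (R (e k)))
      ((‖ξ‖ ^ 2 : ℝ) - ε * inner ℂ ξ (R ξ)) := by
  have h1 := lp.hasSum_inner (𝕜 := ℂ) (T (R ξ)) (T ξ)
  have h2 : (inner ℂ (T (R ξ)) (T ξ) : ℂ) = (‖ξ‖ ^ 2 : ℝ) - ε * inner ℂ ξ (R ξ) := by
    have h3 := hR.left_inv ξ
    rw [map_add, map_smul, ← eq_sub_iff_add_eq] at h3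
    rw [← ContinuousLinearMap.adjoint_inner_right, hR.inner_symm, h3, inner_sub_right,
      inner_smul_right, inner_self_eq_norm_sq_to_K, Complex.ofReal_pow]
    rfl
  rw [h2] at h1
  refine (funext fun k => ?_ : (fun k => inner ℂ (e k) ξ * inner ℂ ξ (R (e k))) = _) ▸ h1
  rw [hT, hT, ← hR.inner_symm, ← inner_conj_symm (R ξ)]
  rfl

/-- With r = ⟨e_k, R e_k⟩, the k-th coordinate of T R e_k is r, so r² ≤ ‖T R e_k‖² ≤ r. -/
theorem IsFrameResolvent.re_inner_le_one (hR : IsFrameResolvent T ε R) (hε : 0 < ε)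
    (hT : IsAnalysisOperator e T) (k : J) : (inner ℂ (e k) (R (e k))).re ≤ 1 := by
  have h1 := hR.re_inner_self (e k)
  have h2 : ‖T (R (e k)) k‖ ≤ ‖T (R (e k))‖ := lp.norm_apply_le_norm (by norm_num) _ k
  rw [hT] at h2
  have h3 := (Complex.re_le_norm _).trans h2
  have h4 := hR.re_inner_self_nonneg hε (e k)
  have h5 : (inner ℂ (e k) (R (e k))).re ^ 2 ≤ ‖T (R (e k))‖ ^ 2 := by gcongr
  have h6 : 0 ≤ ε * ‖R (e k)‖ ^ 2 := by positivity
  nlinarith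

/-- The defect b = δ_k - T R T*δ_k satisfies T*b = εR e_k, whence A‖b‖² ≤ ‖T*b‖² = ε(Re⟨b, δ_k⟩ -
‖b‖²). Thus ‖b‖ ≤ ε/(A + ε), which bounds 1 - Re⟨e_k, R e_k⟩ = Re⟨b, δ_k⟩. -/
theorem IsFrameResolvent.le_mul_re_inner (hR : IsFrameResolvent T ε R) (hε : 0 < ε)
    (hT : IsAnalysisOperator e T) {A : ℝ} (hA : 0 < A)
    (hlow : ∀ c, A * ‖c‖ ^ 2 ≤ ‖T.adjoint c‖ ^ 2) (k : J) :
    A ≤ (A + ε) * (inner ℂ (e k) (R (e k))).re := by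
  classical
  set δ : lp (fun _ : J => ℂ) 2 := lp.single 2 k (1 : ℂ) with hδ
  have hTδ : T.adjoint δ = e k := by
    refine ext_inner_right ℂ fun ξ => ?_
    rw [ContinuousLinearMap.adjoint_inner_left, hδ, lp.inner_single_left, hT]
    simp
  set c := T (R (e k)) with hc
  have hck : inner ℂ δ c = inner ℂ (e k) (R (e k)) := by
    rw [hδ, lp.inner_single_left, hc, hT]
    simp
  have hδδ : inner ℂ δ δ = (1 : ℂ) := by
    rw [hδ, lp.inner_single_left]
    simp
  set b := δ - c with hb
  have h1 : T.adjoint b = (ε : ℂ) • R (e k) := by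
    rw [hb, map_sub, hTδ, sub_eq_iff_eq_add, add_comm]
    exact (hR.right_inv (e k)).symm
  have h2 : (‖T.adjoint b‖ : ℂ) ^ 2 = ε * inner ℂ b c := by
    have h3 : inner ℂ (T.adjoint b) (T.adjoint b) = (ε : ℂ) * inner ℂ b c := by
      conv_lhs => enter [3]; rw [h1]
      rw [inner_smul_right, ContinuousLinearMap.adjoint_inner_left]
    rw [← h3, inner_self_eq_norm_sq_to_K]
    rfl
  have h4 : ‖T.adjoint b‖ ^ 2 = ε * (inner ℂ b c).re := by
    have := congrArg Complex.re h2
    rw [Complex.re_ofReal_mul] at this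
    rw [← this]
    norm_cast
  have h5 : (inner ℂ b c).re = (inner ℂ b δ).re - ‖b‖ ^ 2 := by
    have : c = δ - b := by rw [hb]; abel
    rw [this, inner_sub_right, inner_self_eq_norm_sq_to_K, Complex.sub_re]
    norm_cast
  have h6 : (inner ℂ b δ).re = 1 - (inner ℂ (e k) (R (e k))).re := by
    rw [← hck, hb, inner_sub_left, hδδ, Complex.sub_re, Complex.one_re, ← inner_conj_symm c,
      Complex.conj_re]
  have h7 : (inner ℂ b δ).re ≤ ‖b‖ := by
    refine (Complex.re_le_norm _).trans ((norm_inner_le_norm _ _).trans_eq ?_)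
    have : ‖δ‖ = 1 := by
      rw [hδ, lp.norm_single (by norm_num)]
      simp
    rw [this, mul_one]
  have h8 := hlow b
  rw [h4, h5] at h8
  have h9 : (A + ε) * ‖b‖ ≤ ε := by
    rcases (norm_nonneg b).eq_or_lt with h | h
    · rw [← h, mul_zero]
      exact hε.le
    · refine le_of_mul_le_mul_right ?_ h
      nlinarith
  have h10 : (A + ε) * (inner ℂ b δ).re ≤ (A + ε) * ‖b‖ := by gcongr
  rw [h6] at h10
  linarith

end AnalysisOperator

/-! ### Unfolding integrals over a fundamental domain. -/

section Unfolding

variable {Γ α : Type*} [Group Γ] [MulAction Γ α] [MeasurableSpace α]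
  [MeasurableConstSMul Γ α] {ν : Measure α} [SMulInvariantMeasure Γ α ν] {B : Set α}

theorem MeasureTheory.IsFundamentalDomain.integrableOn_comp_inv_smul {Φ : α → ℂ}
    (hΦ : Integrable Φ ν) (g : Γ) : IntegrableOn (fun x => Φ (g⁻¹ • x)) B ν :=
  ((measurePreserving_smul g⁻¹ ν).integrable_comp_of_integrable hΦ).integrableOn

theorem MeasureTheory.IsFundamentalDomain.summable_integral_norm [Countable Γ]
    (hB : IsFundamentalDomain Γ B ν) {Φ : α → ℂ} (hΦ : Integrable Φ ν) :
    Summable fun g : Γ => ∫ x in B, ‖Φ (g⁻¹ • x)‖ ∂ν := by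
  have h1 := hB.lintegral_eq_tsum' fun x => ‖Φ x‖ₑ
  have h2 : ∑' g : Γ, ∫⁻ x in B, ‖Φ (g⁻¹ • x)‖ₑ ∂ν ≠ ⊤ := h1 ▸ hΦ.2.ne
  refine (ENNReal.summable_toReal h2).congr fun g => ?_
  exact (integral_norm_eq_lintegral_enorm (μ := ν.restrict B)
    (IsFundamentalDomain.integrableOn_comp_inv_smul hΦ g).aestronglyMeasurable).symm

theorem MeasureTheory.IsFundamentalDomain.hasSum_integral [Countable Γ]
    (hB : IsFundamentalDomain Γ B ν) {Φ : α → ℂ} (hΦ : Integrable Φ ν) :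
    HasSum (fun g : Γ => ∫ x in B, Φ (g⁻¹ • x) ∂ν) (∫ x, Φ x ∂ν) := by
  rw [hB.integral_eq_tsum' Φ hΦ]
  have h := hB.summable_integral_norm hΦ
  exact (Summable.of_norm_bounded h fun g => norm_integral_le_integral_norm _).hasSum

theorem MeasureTheory.IsFundamentalDomain.integral_tsum_prod [Countable Γ] {ι : Type*} [Fintype ι]
    (hB : IsFundamentalDomain Γ B ν) {Φ : ι → α → ℂ} (hΦ : ∀ i, Integrable (Φ i) ν) :
    ∫ x in B, ∑' p : ι × Γ, Φ p.1 (p.2⁻¹ • x) ∂ν = ∑ i, ∫ x, Φ i x ∂ν := by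
  have hs := fun i => hB.summable_integral_norm (hΦ i)
  -- Absolute summability licenses exchanging sum and integral.
  have hsum : Summable fun p : ι × Γ => ∫ x in B, ‖Φ p.1 (p.2⁻¹ • x)‖ ∂ν := by
    have aux : ∀ f : ι × Γ → ℝ, (∀ p, 0 ≤ f p) → (∀ i, Summable fun g => f (i, g)) → Summable f :=
      fun f hf hs => (summable_prod_of_nonneg hf).2 ⟨hs, (hasSum_fintype _).summable⟩
    refine aux _ (fun p => ?_) fun i => ?_
    · have : 0 ≤ fun x => ‖Φ p.1 (p.2⁻¹ • x)‖ := fun x => norm_nonneg (Φ p.1 (p.2⁻¹ • x))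
      exact integral_nonneg this
    · exact hs i
  have hint : ∀ p : ι × Γ, Integrable (fun x => Φ p.1 (p.2⁻¹ • x)) (ν.restrict B) :=
    fun p => IsFundamentalDomain.integrableOn_comp_inv_smul (hΦ p.1) p.2
  have h := hasSum_integral_of_summable_integral_norm hint hsum
  have hfib := fun i => hB.hasSum_integral (hΦ i)
  have h2 := h.prod_fiberwise hfib
  exact h2.unique (hasSum_fintype _)

end Unfolding

/-! ### Equivariance of the frame operator under Γ. -/

namespace ProjUnitaryRep

variable {G : Type*} [Group G] [TopologicalSpace G] [MeasurableSpace G]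
  {σ : TwoCocycle G} {H : Type*} [NormedAddCommGroup H] [InnerProductSpace ℂ H]
  (π : ProjUnitaryRep σ H)

/-- The diagonal action of `π x` on `H^d`. -/
noncomputable def diag (d : ℕ) (x : G) :
    PiLp 2 (fun _ : Fin d => H) ≃ₗᵢ[ℂ] PiLp 2 (fun _ : Fin d => H) :=
  LinearIsometryEquiv.piLpCongrRight 2 fun _ => π.toFun x

variable {Γ : Subgroup G} {n d : ℕ} {η : Fin n → Fin d → H}

theorem multiSuperSystem_eq_diag (p : Γ × Fin n) :
    π.multiSuperSystem Γ η p = π.diag d (p.1 : G) (WithLp.toLp 2 (η p.2)) := rfl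

theorem inner_multiSuperSystem_diag (p : Γ × Fin n) (γ : Γ) (ξ : PiLp 2 (fun _ : Fin d => H)) :
    inner ℂ (π.multiSuperSystem Γ η p) (π.diag d (γ : G) ξ) =
      σ.toFun γ (γ⁻¹ * p.1 : Γ) * inner ℂ (π.multiSuperSystem Γ η (γ⁻¹ * p.1, p.2)) ξ := by
  rw [PiLp.inner_apply, PiLp.inner_apply, Finset.mul_sum]
  exact Finset.sum_congr rfl fun j _ => π.coeff_apply_right (η p.2 j) (ξ j) p.1 γ

/-- The action of γ permutes the coordinates of Tξ up to phases common to both vectors. Hence T*T,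
and so R, commutes with the diagonal action. -/
theorem inner_analysisOperator_diag
    {T : PiLp 2 (fun _ : Fin d => H) →L[ℂ] lp (fun _ : Γ × Fin n => ℂ) 2}
    (hT : IsAnalysisOperator (π.multiSuperSystem Γ η) T) (γ : Γ)
    (ξ ξ' : PiLp 2 (fun _ : Fin d => H)) :
    inner ℂ (T (π.diag d (γ : G) ξ')) (T (π.diag d (γ : G) ξ)) = inner ℂ (T ξ') (T ξ) := by
  rw [lp.inner_eq_tsum, lp.inner_eq_tsum]
  rw [← ((Equiv.mulLeft γ⁻¹).prodCongr (Equiv.refl (Fin n))).tsum_eq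
    fun p => inner ℂ (T ξ' p) (T ξ p)]
  refine tsum_congr fun p => ?_
  have key : ∀ (z : Circle) (a b : ℂ), inner ℂ ((z : ℂ) * a) (z * b) = inner ℂ a b := by
    intro z a b
    rw [RCLike.inner_apply, RCLike.inner_apply, RingHom.map_mul]
    linear_combination (b * starRingEnd ℂ a) * circle_mul_conj z
  rw [hT, hT, inner_multiSuperSystem_diag, inner_multiSuperSystem_diag, key, ← hT, ← hT]
  rfl

end ProjUnitaryRep

theorem inner_piLp_single_right {H : Type*} [NormedAddCommGroup H] [InnerProductSpace ℂ H] {d : ℕ}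
    (ξ : PiLp 2 (fun _ : Fin d => H)) (j : Fin d) (v : H) :
    inner ℂ ξ (PiLp.single 2 j v) = inner ℂ (ξ j) v := by
  rw [PiLp.inner_apply, Finset.sum_eq_single j]
  · simp
  · intro k _ hk
    simp [hk]
  · simp

theorem inner_piLp_single_left {H : Type*} [NormedAddCommGroup H] [InnerProductSpace ℂ H] {d : ℕ}
    (ξ : PiLp 2 (fun _ : Fin d => H)) (j : Fin d) (v : H) :
    inner ℂ (PiLp.single 2 j v) ξ = inner ℂ v (ξ j) := by
  rw [← inner_conj_symm, inner_piLp_single_right, inner_conj_symm]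

theorem MeasureTheory.IsFundamentalDomain.covolume_subgroup {G : Type*} [Group G]
    [TopologicalSpace G] [IsTopologicalGroup G] [SecondCountableTopology G] [MeasurableSpace G]
    [BorelSpace G] {μ : Measure G} [μ.IsMulLeftInvariant] {Γ : Subgroup G} [Countable Γ] {B : Set G}
    (hB : IsFundamentalDomain Γ B μ) : covolume Γ G μ = μ B :=
  hB.covolume_eq_volume μ

/-! ### The averaged identity over a fundamental domain. -/

namespace ProjUnitaryRep

variable {G : Type*} [Group G] [TopologicalSpace G] [IsTopologicalGroup G]
  [SecondCountableTopology G] [MeasurableSpace G] [BorelSpace G]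
  {σ : TwoCocycle G} {H : Type*} [NormedAddCommGroup H] [InnerProductSpace ℂ H]
  [CompleteSpace H] {π : ProjUnitaryRep σ H} {Γ : Subgroup G} {n d : ℕ} {η : Fin n → Fin d → H}
  {T : PiLp 2 (fun _ : Fin d => H) →L[ℂ] lp (fun _ : Γ × Fin n => ℂ) 2} {ε : ℝ}
  {R : PiLp 2 (fun _ : Fin d => H) →L[ℂ] PiLp 2 (fun _ : Fin d => H)}
  {μ : Measure G} [μ.IsMulLeftInvariant] [μ.IsInvInvariant] {dπ : ℝ} {B : Set G}

/-- Equivariance of R makes each (γ, i) term a function of γ⁻¹x alone, the form needed for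
unfolding. -/
theorem tsum_coeff_mul_conj_coeff (hT : IsAnalysisOperator (π.multiSuperSystem Γ η) T)
    (hR : IsFrameResolvent T ε R) (h : H) (j : Fin d) (x : G) :
    ∑' p : Fin n × Γ, π.coeff (η p.1 j) h (p.2⁻¹ • x)⁻¹ *
        starRingEnd ℂ (π.coeff (R (WithLp.toLp 2 (η p.1)) j) h (p.2⁻¹ • x)⁻¹) =
      ((‖h‖ ^ 2 : ℝ) : ℂ) - ε * inner ℂ (PiLp.single 2 j (π.toFun x h))
        (R (PiLp.single 2 j (π.toFun x h))) := by
  have h1 := hR.hasSum hT (PiLp.single 2 j (π.toFun x h))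
  rw [PiLp.norm_single, LinearIsometryEquiv.norm_map] at h1
  rw [← h1.tsum_eq, ← (Equiv.prodComm (Fin n) Γ).tsum_eq]
  refine tsum_congr fun p => ?_
  rw [Equiv.prodComm_apply, inner_piLp_single_right, inner_piLp_single_left,
    multiSuperSystem_eq_diag, hR.commute _ fun _ _ => π.inner_analysisOperator_diag hT _ _ _]
  have h2 : (p.2⁻¹ • x)⁻¹ = x⁻¹ * p.2 := by
    rw [Subgroup.smul_def, smul_eq_mul, mul_inv_rev]
    simp
  rw [h2, ← coeff_mul_conj_coeff_apply_right]
  congr 1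
  exact inner_conj_symm _ _

theorem integral_fundamentalDomain [Countable Γ] (hT : IsAnalysisOperator (π.multiSuperSystem Γ η) T)
    (hR : IsFrameResolvent T ε R) (hd : π.IsFormalDimension μ dπ) (hB : IsFundamentalDomain Γ B μ)
    (h : H) (j : Fin d) :
    ∫ x in B, ((‖h‖ ^ 2 : ℝ) - ε * inner ℂ (PiLp.single 2 j (π.toFun x h))
        (R (PiLp.single 2 j (π.toFun x h))) : ℂ) ∂μ =
      (dπ : ℂ)⁻¹ * (‖h‖ ^ 2 : ℝ) * ∑ i, inner ℂ (η i j) (R (WithLp.toLp 2 (η i)) j) := by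
  simp only [← tsum_coeff_mul_conj_coeff hT hR]
  have hint : ∀ i, Integrable (fun x : G => π.coeff (η i j) h x⁻¹ *
      starRingEnd ℂ (π.coeff (R (WithLp.toLp 2 (η i)) j) h x⁻¹)) μ := fun i =>
    (hd.2 h (η i j) h (R (WithLp.toLp 2 (η i)) j)).1.comp_inv
  rw [hB.integral_tsum_prod hint, Finset.mul_sum]
  refine Finset.sum_congr rfl fun i _ => ?_
  -- Unfolding produces coefficients at x⁻¹; inversion invariance restores x.
  have h1 := integral_inv_eq_self (fun x : G => π.coeff (η i j) h x *
      starRingEnd ℂ (π.coeff (R (WithLp.toLp 2 (η i)) j) h x)) μ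
  refine h1.trans ((hd.2 h (η i j) h (R (WithLp.toLp 2 (η i)) j)).2.trans ?_)
  rw [inner_conj_symm, inner_self_eq_norm_sq_to_K, Complex.ofReal_pow, mul_assoc]
  rfl

theorem continuous_inner_single (π : ProjUnitaryRep σ H)
    (R : PiLp 2 (fun _ : Fin d => H) →L[ℂ] PiLp 2 (fun _ : Fin d => H)) (h : H) (j : Fin d) :
    Continuous fun x : G => inner ℂ (PiLp.single 2 j (π.toFun x h))
        (R (PiLp.single 2 j (π.toFun x h))) := by
  have h1 : Continuous fun x : G =>
      (PiLp.single 2 j (π.toFun x h) : PiLp 2 (fun _ : Fin d => H)) :=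
    (PiLp.continuous_toLp 2 _).comp ((continuous_single j).comp (π.continuous' h))
  exact h1.inner (R.continuous.comp h1)

theorem integrableOn_inner_single (π : ProjUnitaryRep σ H)
    (R : PiLp 2 (fun _ : Fin d => H) →L[ℂ] PiLp 2 (fun _ : Fin d => H)) (hfin : μ B < ⊤)
    (h : H) (j : Fin d) :
    IntegrableOn (fun x : G => inner ℂ (PiLp.single 2 j (π.toFun x h))
        (R (PiLp.single 2 j (π.toFun x h)))) B μ := by
  have : IsFiniteMeasure (μ.restrict B) := ⟨by simpa using hfin⟩
  refine Integrable.of_bound (continuous_inner_single π R h j).aestronglyMeasurable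
    (‖h‖ * (‖R‖ * ‖h‖)) (Filter.Eventually.of_forall fun x => ?_)
  have h1 : ‖(PiLp.single 2 j (π.toFun x h) : PiLp 2 (fun _ : Fin d => H))‖ = ‖h‖ := by
    rw [PiLp.norm_single, LinearIsometryEquiv.norm_map]
  refine (norm_inner_le_norm _ _).trans ?_
  rw [h1]
  gcongr
  exact (R.le_opNorm _).trans_eq (by rw [h1])

theorem sum_integral_fundamentalDomain [Countable Γ]
    (hT : IsAnalysisOperator (π.multiSuperSystem Γ η) T)
    (hR : IsFrameResolvent T ε R) (hd : π.IsFormalDimension μ dπ) (hB : IsFundamentalDomain Γ B μ)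
    (hfin : μ B < ⊤) {h : H} (hh : ‖h‖ = 1) :
    ∑ j : Fin d, ∫ x in B, (1 - ε * (inner ℂ (PiLp.single 2 j (π.toFun x h))
        (R (PiLp.single 2 j (π.toFun x h)))).re) ∂μ =
      dπ⁻¹ * ∑ i, (inner ℂ (π.multiSuperSystem Γ η (1, i)) (R (π.multiSuperSystem Γ η (1, i)))).re := by
  have : IsFiniteMeasure (μ.restrict B) := ⟨by simpa using hfin⟩
  have h1 : ∀ j : Fin d, ∫ x in B, (1 - ε * (inner ℂ (PiLp.single 2 j (π.toFun x h))
        (R (PiLp.single 2 j (π.toFun x h)))).re) ∂μ =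
      dπ⁻¹ * ∑ i, (inner ℂ (η i j) (R (WithLp.toLp 2 (η i)) j)).re := by
    intro j
    have h2 := congrArg Complex.re (integral_fundamentalDomain hT hR hd hB h j)
    have hint := (integrable_const (μ := μ.restrict B) ((‖h‖ ^ 2 : ℝ) : ℂ)).sub
      ((integrableOn_inner_single π R hfin h j).const_mul (ε : ℂ))
    have h3 := integral_re hint
    rw [hh, one_pow, Complex.ofReal_one, mul_one, ← Complex.ofReal_inv, Complex.re_ofReal_mul,
      Complex.re_sum] at h2
    rw [← h2]
    refine Eq.trans ?_ (h3.trans ?_)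
    · refine integral_congr_ae (Filter.Eventually.of_forall fun x => ?_)
      simp [hh]
    · simp [hh]
  rw [Finset.sum_congr rfl fun j _ => h1 j, ← Finset.mul_sum, Finset.sum_comm]
  congr 1
  refine Finset.sum_congr rfl fun i _ => ?_
  have h4 : π.multiSuperSystem Γ η (1, i) = WithLp.toLp 2 (η i) := by
    ext j
    exact π.map_one _
  rw [h4, PiLp.inner_apply, Complex.re_sum]

/-! ### Density inequalities as ε → 0. -/

variable [Nontrivial H]

theorem covolume_mul_le_of_isFrame [Countable Γ] (hd : π.IsFormalDimension μ dπ)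
    (hB : IsFundamentalDomain Γ B μ) (hfin : μ B < ⊤) (hη : IsFrame (π.multiSuperSystem Γ η)) :
    d * (dπ * μ.real B) ≤ n := by
  have : IsFiniteMeasure (μ.restrict B) := ⟨by simpa using hfin⟩
  obtain ⟨T, hT, A, hA, hlow⟩ := hη.exists_analysisOperator
  obtain ⟨h, hh⟩ := exists_norm_eq H zero_le_one
  have hdpos := hd.1
  have key : ∀ ε : ℝ, 0 < ε → A * (d * (dπ * μ.real B)) ≤ (A + ε) * n := by
    intro ε hε
    obtain ⟨R, hR⟩ := exists_isFrameResolvent T hε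
    have h1 := sum_integral_fundamentalDomain hT hR hd hB hfin hh
    have h2 : ∑ i, (inner ℂ (π.multiSuperSystem Γ η (1, i))
        (R (π.multiSuperSystem Γ η (1, i)))).re ≤ n := by
      refine (Finset.sum_le_sum fun i _ => hR.re_inner_le_one hε hT (1, i)).trans_eq ?_
      simp
    have h3 : ∀ j : Fin d, A / (A + ε) * μ.real B ≤ ∫ x in B,
        (1 - ε * (inner ℂ (PiLp.single 2 j (π.toFun x h))
        (R (PiLp.single 2 j (π.toFun x h)))).re) ∂μ := by
      intro j
      rw [mul_comm, ← smul_eq_mul, ← setIntegral_const]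
      refine integral_mono (integrable_const _) ((integrable_const _).sub
        ((integrableOn_inner_single π R hfin h j).re.const_mul ε)) fun x => ?_
      have h4 := hR.mul_re_inner_self_le hε hA.le hlow (PiLp.single 2 j (π.toFun x h))
      rw [PiLp.norm_single, LinearIsometryEquiv.norm_map, hh, one_pow] at h4
      change A / (A + ε) ≤ 1 - ε * _
      rw [div_le_iff₀ (by positivity)]
      linear_combination ε * h4
    have h5 := Finset.sum_le_sum fun j (_ : j ∈ Finset.univ) => h3 j
    rw [h1] at h5
    simp only [Finset.sum_const, Finset.card_univ, Fintype.card_fin, nsmul_eq_mul] at h5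
    have h6 : d * (A / (A + ε) * μ.real B) ≤ dπ⁻¹ * n := h5.trans (by gcongr)
    have h7 : 0 < A + ε := by positivity
    calc A * (d * (dπ * μ.real B)) = (A + ε) * dπ * (d * (A / (A + ε) * μ.real B)) := by
          field_simp
      _ ≤ (A + ε) * dπ * (dπ⁻¹ * n) := by gcongr
      _ = (A + ε) * n := by field_simp
  refine le_of_mul_le_mul_left (le_of_forall_pos_le_add fun δ hδ => ?_) hA
  -- This choice of ε makes εn ≤ δ, also when n = 0.
  refine (key (δ / (n + 1)) (by positivity)).trans ?_
  rw [add_mul, add_le_add_iff_left, div_mul_eq_mul_div, div_le_iff₀ (by positivity)]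
  linarith

theorem le_covolume_mul_of_isRieszSequence [Countable Γ] (hd : π.IsFormalDimension μ dπ)
    (hB : IsFundamentalDomain Γ B μ) (hfin : μ B < ⊤)
    (hη : IsRieszSequence (π.multiSuperSystem Γ η)) :
    n ≤ d * (dπ * μ.real B) := by
  have : IsFiniteMeasure (μ.restrict B) := ⟨by simpa using hfin⟩
  obtain ⟨T, hT, A, hA, hlow⟩ := hη.exists_analysisOperator
  obtain ⟨h, hh⟩ := exists_norm_eq H zero_le_one
  have hdpos := hd.1
  have hpos : 0 ≤ d * (dπ * μ.real B) := by positivity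
  set D := d * (dπ * μ.real B) with hD
  have key : ∀ ε : ℝ, 0 < ε → A * n ≤ (A + ε) * D := by
    intro ε hε
    obtain ⟨R, hR⟩ := exists_isFrameResolvent T hε
    have h1 := sum_integral_fundamentalDomain hT hR hd hB hfin hh
    have h2 : n * A ≤ (A + ε) * ∑ i, (inner ℂ (π.multiSuperSystem Γ η (1, i))
        (R (π.multiSuperSystem Γ η (1, i)))).re := by
      rw [Finset.mul_sum]
      refine le_trans (le_of_eq ?_)
        (Finset.sum_le_sum fun i _ => hR.le_mul_re_inner hε hT hA hlow (1, i))
      simp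
    have h3 : ∀ j : Fin d, ∫ x in B,
        (1 - ε * (inner ℂ (PiLp.single 2 j (π.toFun x h))
        (R (PiLp.single 2 j (π.toFun x h)))).re) ∂μ ≤ μ.real B := by
      intro j
      rw [← mul_one (μ.real B), ← smul_eq_mul, ← setIntegral_const]
      refine integral_mono ((integrable_const _).sub
        ((integrableOn_inner_single π R hfin h j).re.const_mul ε)) (integrable_const _) fun x => ?_
      exact sub_le_self _ (mul_nonneg hε.le (hR.re_inner_self_nonneg hε _))
    have h5 := Finset.sum_le_sum fun j (_ : j ∈ Finset.univ) => h3 j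
    rw [h1] at h5
    simp only [Finset.sum_const, Finset.card_univ, Fintype.card_fin, nsmul_eq_mul] at h5
    have h7 : 0 < A + ε := by positivity
    have h8 := mul_le_mul_of_nonneg_left h5 (mul_pos h7 hdpos).le
    rw [mul_assoc (A + ε), mul_inv_cancel_left₀ hdpos.ne'] at h8
    rw [hD]
    linarith
  refine le_of_mul_le_mul_left (le_of_forall_pos_le_add fun δ hδ => ?_) hA
  refine (key (δ / (D + 1)) (by positivity)).trans ?_
  rw [add_mul, add_le_add_iff_left, div_mul_eq_mul_div, div_le_iff₀ (by positivity)]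
  linarith

end ProjUnitaryRep

theorem theorem5p4 {G : Type*} [Group G] [TopologicalSpace G] [IsTopologicalGroup G]
    [LocallyCompactSpace G] [T2Space G] [SecondCountableTopology G]
    [MeasurableSpace G] [BorelSpace G]
    (μ : Measure G) [μ.IsHaarMeasure] [μ.IsMulRightInvariant]
    {H : Type*} [NormedAddCommGroup H] [InnerProductSpace ℂ H] [CompleteSpace H]
    (σ : TwoCocycle G) (π : ProjUnitaryRep σ H)
    (hirr : π.IsIrreducible) (hsq : π.IsSquareIntegrable μ)
    (Γ : Subgroup G) (hΓ : IsLatticeSubgroup μ Γ) :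
    (∃! dπ : ℝ, π.IsFormalDimension μ dπ) ∧
    ∀ dπ : ℝ, π.IsFormalDimension μ dπ → ∀ n d : ℕ, 0 < n → 0 < d →
      (π.AdmitsSuperFrame Γ n d → dπ * (covolume Γ G μ).toReal ≤ (n : ℝ) / d) ∧
      (π.AdmitsSuperRieszSequence Γ n d → (n : ℝ) / d ≤ dπ * (covolume Γ G μ).toReal) ∧
      (π.AdmitsSuperRieszBasis Γ n d → dπ * (covolume Γ G μ).toReal = (n : ℝ) / d) := by
  have hnt : Nontrivial H := hirr.1
  have hinv := Measure.IsHaarMeasure.isInvInvariant_of_isMulRightInvariant μ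
  obtain ⟨dπ₀, h₀⟩ := ProjUnitaryRep.exists_isFormalDimension μ hirr hsq
  refine ⟨⟨dπ₀, h₀, fun d hd => hd.unique h₀⟩, fun dπ hdπ n d hn hd => ?_⟩
  obtain ⟨hdisc, B, hB, hfin⟩ := hΓ
  -- A separable discrete space is countable.
  have hcount : Countable Γ := TopologicalSpace.separableSpace_iff_countable.1 inferInstance
  have hd' : (0 : ℝ) < d := by exact_mod_cast hd
  rw [hB.covolume_subgroup]
  have hframe : π.AdmitsSuperFrame Γ n d → dπ * (μ B).toReal ≤ (n : ℝ) / d := by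
    rintro ⟨η, hη⟩
    rw [le_div_iff₀ hd', mul_comm]
    exact ProjUnitaryRep.covolume_mul_le_of_isFrame hdπ hB hfin hη
  have hriesz : π.AdmitsSuperRieszSequence Γ n d → (n : ℝ) / d ≤ dπ * (μ B).toReal := by
    rintro ⟨η, hη⟩
    rw [div_le_iff₀ hd', mul_comm]
    exact ProjUnitaryRep.le_covolume_mul_of_isRieszSequence hdπ hB hfin hη
  exact ⟨hframe, hriesz, fun ⟨η, h1, h2⟩ => le_antisymm (hframe ⟨η, h1⟩) (hriesz ⟨η, h2⟩)⟩
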